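/- **Setting.** A server and $n$ nodes with identifiers $1,\dots,n$ communicate in synchronous rounds. Node $i$ holds a data item $x_i$; the items $x_1,\dots,x_n$ are pairwise distinct elements of an infinite totally ordered set $D$, and the rank of an item is its position in the increasing order of $x_1,\dots,x_n$. In each round the server may send a broadcast message, received by all nodes, and a single cast message to each node, and then each node may send a message to the server. Every message, broadcast or single cast, costs one; messages are taken from an arbitrary countable set (for instance all bit strings), without any bound on their length. The server acts on everything it has sent and received so far; a node acts on its identifier, its item, and everything it has sent and received so far (including what it receives from the server in the current round). All actions may moreover depend on random coins, i.e. on the outcome of an arbitrary probability space, which may even be shared by all parties. An algorithm has a finite number of rounds that is fixed in advance (it may depend on $n$ in any way, in particular it may be polylogarithmic in $n$), after which the server outputs an element of $D$. **Statement.** Let $c>1$ and $C>0$. There are $\kappa>0$ and $n_0\in\mathbb{N}$, depending only on $c$ and $C$, such that the following holds for all $n\ge n_0$, all infinite totally ordered sets $D$ and all algorithms for $n$ nodes as above. If for every input $(x_1,\dots,x_n)$ of pairwise distinct elements of $D$ the algorithm outputs, with probability at least $1-\frac{1}{\log n}$, one of the items $x_1,\dots,x_n$ whose rank is at most $C\log^c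 n$, then there is an input of pairwise distinct elements of $D$ on which the expected number of messages is at least $\kappa\log n$. Here $\log$ is the natural logarithm. In short: every algorithm that outputs an item of rank $O(\log^c n)$ with success probability at least $1-\frac1{\log n}$ uses $\Omega(\log n)$ messages in expectation in the worst case. -/

import Mathlib

open MeasureTheory

/-- Everything that is sent in one communication round between the server and `n` nodes
(`none` means that nothing is sent): first the server may send a broadcast message, received by all
nodes, and a single cast message to each node; then each node may send a message to the server. -/
structure CommRound (n : ℕ) (M : Type*) where
  broadcast : Option M
  unicast : Fin n → Option M
  reply : Fin n → Option M

/-- What node `i` sees of a round: the broadcast, its own single cast message, and its own reply. -/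
def CommRound.view {n : ℕ} {M : Type*} (ρ : CommRound n M) (i : Fin n) :
    Option M × Option M × Option M :=
  (ρ.broadcast, ρ.unicast i, ρ.reply i)

/-- The number of messages of a round; a broadcast and a single cast message both cost one. -/
def CommRound.cost {n : ℕ} {M : Type*} (ρ : CommRound n M) : ℕ :=
  (if ρ.broadcast.isSome then 1 else 0)
    + (Finset.univ.filter fun i => (ρ.unicast i).isSome = true).card
    + (Finset.univ.filter fun i => (ρ.reply i).isSome = true).card

/-- A randomized algorithm for one server and `n` nodes, each of which holds one data item from `D`.
It runs for `rounds` synchronous rounds with messages from `M`; the outcome `ω : Ω` is the outcome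
of all coin tosses (private coins are the special case in which every party only uses its own
component of `ω`). Histories are lists of past rounds, the most recent one first.

* The server acts on what it has sent and received so far.
* A node acts on its identifier, its data item, what it has sent and received in earlier rounds, and
  the broadcast and the single cast message that it receives in the current round.
* After the last round the server outputs a data item.

The last fields say that every single action is a random variable. -/
structure MonitoringAlgorithm (n : ℕ) (D M Ω : Type*) [MeasurableSpace Ω] where
  rounds : ℕ
  broadcast : Ω → List (CommRound n M) → Option M
  unicast : Ω → List (CommRound n M) → Fin n → Option M
  respond : Ω → (i : Fin n) → D → List (Option M × Option M × Option M) →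
    (received_broadcast received_unicast : Option M) → Option M
  output : Ω → List (CommRound n M) → D
  measurableSet_broadcast : ∀ h m, MeasurableSet {ω | broadcast ω h = m}
  measurableSet_unicast : ∀ h i m, MeasurableSet {ω | unicast ω h i = m}
  measurableSet_respond : ∀ i d v b u m, MeasurableSet {ω | respond ω i d v b u = m}
  measurableSet_output : ∀ h d, MeasurableSet {ω | output ω h = d}

namespace MonitoringAlgorithm

variable {n : ℕ} {D M Ω : Type*} [MeasurableSpace Ω]

/-- The round that follows the history `h` when node `i` holds the data item `x i`. -/
def step (A : MonitoringAlgorithm n D M Ω) (ω : Ω) (x : Fin n → D) (h : List (CommRound n M)) :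
    CommRound n M where
  broadcast := A.broadcast ω h
  unicast := A.unicast ω h
  reply i := A.respond ω i (x i) (h.map fun ρ => ρ.view i) (A.broadcast ω h) (A.unicast ω h i)

/-- The history after the first `r` rounds. -/
def history (A : MonitoringAlgorithm n D M Ω) (ω : Ω) (x : Fin n → D) : ℕ → List (CommRound n M)
  | 0 => []
  | r + 1 => A.step ω x (A.history ω x r) :: A.history ω x r

/-- The total number of messages exchanged on the input `x`. -/
def messages (A : MonitoringAlgorithm n D M Ω) (ω : Ω) (x : Fin n → D) : ℕ :=
  ((A.history ω x A.rounds).map CommRound.cost).sum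

/-- The data item that the server outputs on the input `x`. -/
def result (A : MonitoringAlgorithm n D M Ω) (ω : Ω) (x : Fin n → D) : D :=
  A.output ω (A.history ω x A.rounds)

end MonitoringAlgorithm

/-- The rank of a data item `d` among the data items `x`: its position (from `1`) in the sorted
ordering. -/
def dataRank {n : ℕ} {D : Type*} [LinearOrder D] (x : Fin n → D) (d : D) : ℕ :=
  (Finset.univ.filter fun j => x j ≤ d).card

/-- `d` is one of the data items `x`, and its rank is at most `L`. -/
def IsItemOfRankAtMost {n : ℕ} {D : Type*} [LinearOrder D] (x : Fin n → D) (L : ℝ) (d : D) : Prop :=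
  d ∈ Set.range x ∧ (dataRank x d : ℝ) ≤ L

/-! The bound comes from a harmonic sum: on a random assignment of fixed items to nodes, the holder
of the item of rank `r` must speak with probability at least about `1 / (2 * r)`, for every `r` from
`L = C * log n ^ c` up to `n`.

Fix `r ≥ L` and let `T` be the holders of the `r` lowest items. While `T` is silent, the execution
does not depend on the items in `T`, so the server could only guess an acceptable item. Hence some
node of `T` speaks with substantial probability, and it remains to show that the holder of the
largest item in `T` has at least an average share of being a first speaker.

For this, let `j` and `j'` in `T` hold neighbouring items `z` and `w`. The event that `j` is a first
speaker is an intersection of an event determined by `z` and one determined by `w`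
(`firstReply_update`). By Ramsey's theorem (`exists_strictMonoOn_almost_constant`) its probability
depends, up to a small error, only on whether `z < w`. A long half graph of such intersections
cannot have a large gap (`sub_le_of_measureReal_inter_halfGraph`), so raising the item of `j` past
that of `j'` hardly lowers the probability. These swaps, averaged over all assignments, give the
share (`factorial_div_le_firstReplySum`). The Ramsey error may depend on `n` and on the number of
rounds, so neither that number nor the message length enters the bound. -/

/-! ### Ramsey's theorem and almost constant functions of increasing tuples -/

/-- Ramsey's theorem for `r`-element subsets of an infinite set and finitely many colours. -/
theorem exists_infinite_monochromatic {α κ : Type*} [DecidableEq α] [Finite κ] (r : ℕ) :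
    ∀ (c : Finset α → κ) (X : Set α), X.Infinite →
      ∃ Y ⊆ X, Y.Infinite ∧ ∃ k, ∀ s : Finset α, (s : Set α) ⊆ Y → s.card = r → c s = k := by
  induction r with
  | zero =>
    intro c X hX
    refine ⟨X, subset_rfl, hX, c ∅, fun s _ hs => ?_⟩
    rw [Finset.card_eq_zero.mp hs]
  | succ r ih =>
    intro c X hX
    -- Peel off a point `a` and shrink the rest so that the colour of `insert a s` depends on `a`
    -- alone.
    have key : ∀ X : {X : Set α // X.Infinite}, ∃ a ∈ X.1, ∃ Y : {Y : Set α // Y.Infinite},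
        Y.1 ⊆ X.1 \ {a} ∧
          ∃ k, ∀ s : Finset α, (s : Set α) ⊆ Y.1 → s.card = r → c (insert a s) = k := by
      rintro ⟨X, hX⟩
      obtain ⟨a, ha⟩ := hX.nonempty
      obtain ⟨Y, hYX, hY, k, hk⟩ := ih (fun s => c (insert a s)) (X \ {a})
        (hX.sdiff (Set.finite_singleton a))
      exact ⟨a, ha, ⟨Y, hY⟩, hYX, k, hk⟩
    choose a ha Y hY k hk using key
    let Z : ℕ → {X : Set α // X.Infinite} := fun i => Y^[i] ⟨X, hX⟩
    have hZ : ∀ i, Z (i + 1) = Y (Z i) := fun i => Function.iterate_succ_apply' _ _ _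
    have hanti : Antitone fun i => (Z i).1 := antitone_nat_of_succ_le fun i => by
      rw [hZ]
      exact (hY _).trans Set.sdiff_subset
    have hmem : ∀ i j, i < j → a (Z j) ∈ (Y (Z i)).1 := fun i j hij => by
      rw [← hZ]
      exact hanti (Nat.succ_le_of_lt hij) (ha _)
    have hne : ∀ i j, i < j → a (Z j) ≠ a (Z i) := fun i j hij => (hY _ (hmem i j hij)).2
    have hinj : Function.Injective fun i => a (Z i) := by
      intro i j hij
      rcases lt_trichotomy i j with h | h | h
      · exact absurd hij.symm (hne _ _ h)
      · exact h
      · exact absurd hij (hne _ _ h)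
    -- Each set of peeled points has the colour attached to its earliest point; keep only the points
    -- with one common attached colour.
    obtain ⟨k₀, hk₀⟩ := Finite.exists_infinite_fiber fun i => k (Z i)
    refine ⟨(fun i => a (Z i)) '' ((fun i => k (Z i)) ⁻¹' {k₀}), ?_,
      (Set.infinite_coe_iff.mp hk₀).image hinj.injOn, k₀, ?_⟩
    · rintro _ ⟨i, -, rfl⟩
      exact hanti (Nat.zero_le i) (ha _)
    · intro s hs hcard
      obtain ⟨t, ht, rfl⟩ := Finset.subset_set_image_iff.mp hs
      rw [Finset.card_image_of_injective _ hinj] at hcard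
      have htne : t.Nonempty := Finset.card_pos.mp (by omega)
      have hmin := t.min'_mem htne
      set i := t.min' htne with hi
      rw [← Finset.insert_erase hmin, Finset.image_insert, hk (Z i)]
      · exact ht hmin
      · intro d hd
        obtain ⟨j, hj, rfl⟩ := Finset.mem_image.mp (Finset.mem_coe.mp hd)
        have hj' := Finset.mem_erase.mp hj
        exact hmem i j (lt_of_le_of_ne (t.min'_le j hj'.2) hj'.1.symm)
      · rw [Finset.card_image_of_injective _ hinj, Finset.card_erase_of_mem hmin, hcard]
        rfl

/-- Finitely many bounded functions of increasing `n`-tuples are almost constant on the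
increasing `n`-tuples from a suitable long increasing sequence. -/
theorem exists_strictMonoOn_almost_constant {D ι : Type*} [LinearOrder D] [Infinite D] [Finite ι]
    {n : ℕ} (Φ : ι → (Fin n → D) → ℝ) (h0 : ∀ i x, 0 ≤ Φ i x) (h1 : ∀ i x, Φ i x ≤ 1)
    {ε : ℝ} (hε : 0 < ε) (N : ℕ) :
    ∃ s : ℕ → D, StrictMonoOn s (Set.Iio N) ∧ ∀ i (f g : Fin n → ℕ), StrictMono f → StrictMono g →
      (∀ l, f l < N) → (∀ l, g l < N) → Φ i (fun l => s (f l)) ≤ Φ i (fun l => s (g l)) + ε := by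
  classical
  have hfl : ∀ i x, ⌊Φ i x / ε⌋₊ < ⌊1 / ε⌋₊ + 1 := fun i x =>
    Nat.lt_succ_of_le (Nat.floor_le_floor (by gcongr; exact h1 i x))
  -- The colour of an `n`-set records all values of `Φ` on its increasing enumeration, rounded down
  -- to multiples of `ε`. The colour `0` of other sets is never used.
  let c : Finset D → ι → Fin (⌊1 / ε⌋₊ + 1) := fun s =>
    if h : s.card = n then fun i => ⟨⌊Φ i (s.orderEmbOfFin h) / ε⌋₊, hfl _ _⟩ else fun _ => 0
  obtain ⟨Y, -, hY, k, hk⟩ := exists_infinite_monochromatic n c Set.univ Set.infinite_univ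
  obtain ⟨F, hFY, hFc⟩ := hY.exists_subset_card_eq N
  let e := F.orderEmbOfFin hFc
  obtain ⟨d⟩ : Nonempty D := inferInstance
  let s : ℕ → D := fun l => if h : l < N then e ⟨l, h⟩ else d
  have hs : ∀ l (h : l < N), s l = e ⟨l, h⟩ := fun l h => dif_pos h
  have hmono : StrictMonoOn s (Set.Iio N) := by
    intro a ha b hb hab
    rw [hs a ha, hs b hb]
    exact e.strictMono hab
  have hcol : ∀ i (f : Fin n → ℕ), StrictMono f → (∀ l, f l < N) →
      ⌊Φ i (fun l => s (f l)) / ε⌋₊ = (k i : ℕ) := by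
    intro i f hf hfN
    have hsf : StrictMono fun l => s (f l) := fun a b hab => hmono (hfN a) (hfN b) (hf hab)
    have hcard : (Finset.univ.image fun l => s (f l)).card = n := by
      rw [Finset.card_image_of_injective _ hsf.injective, Finset.card_univ, Fintype.card_fin]
    have hc := hk (Finset.univ.image fun l => s (f l)) (fun d hd => by
      obtain ⟨l, -, rfl⟩ := Finset.mem_image.mp (Finset.mem_coe.mp hd)
      rw [hs _ (hfN l)]
      exact hFY (F.orderEmbOfFin_mem hFc _)) hcard
    have hu := Finset.orderEmbOfFin_unique hcard
      (fun l => Finset.mem_image_of_mem (fun l => s (f l)) (Finset.mem_univ l)) hsf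
    rw [← hc]
    simp only [c, dif_pos hcard]
    rw [← hu]
  refine ⟨s, hmono, fun i f g hf hg hfN hgN => ?_⟩
  have h := (hcol i f hf hfN).trans (hcol i g hg hgN).symm
  have hlt := Nat.lt_floor_add_one (Φ i (fun l => s (f l)) / ε)
  have hle := Nat.floor_le (div_nonneg (h0 i (fun l => s (g l))) hε.le)
  rw [h] at hlt
  have : Φ i (fun l => s (f l)) / ε < Φ i (fun l => s (g l)) / ε + 1 := by linarith
  rw [div_lt_iff₀ hε, add_mul, div_mul_cancel₀ _ hε.ne'] at this
  linarith

/-! ### Half graphs in Hilbert space and in probability spaces -/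

open RealInnerProductSpace in
/-- An energy increment for vectors whose inner products with vectors of the unit ball form a half
graph pattern. -/
theorem sq_norm_sum_add_le_of_inner_halfGraph {H : Type*} [NormedAddCommGroup H]
    [InnerProductSpace ℝ H] {a b : ℕ → H} {u v : ℝ} (huv : v ≤ u) (hb : ∀ q, ‖b q‖ ≤ 1) (k : ℕ) :
    ∀ o : ℕ, (∀ p q, o ≤ p → p ≤ q → q < o + 2 ^ k → u ≤ ⟪a p, b q⟫) →
      (∀ p q, o ≤ q → q < p → p < o + 2 ^ k → ⟪a p, b q⟫ ≤ v) →
      ‖∑ p ∈ Finset.range (2 ^ k), a (o + p)‖ ^ 2 + k * (u - v) ^ 2 / 4 * 4 ^ k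
        ≤ 2 ^ k * ∑ p ∈ Finset.range (2 ^ k), ‖a (o + p)‖ ^ 2 := by
  induction k with
  | zero => intro o _ _; simp
  | succ k ih =>
    intro o hu hv
    have h2 : 2 ^ (k + 1) = 2 ^ k + 2 ^ k := by ring
    have hpos : 0 < 2 ^ k := by positivity
    have hL := ih o (fun p q h h' h'' => hu p q h h' (by omega))
      (fun p q h h' h'' => hv p q h h' (by omega))
    have hR := ih (o + 2 ^ k) (fun p q h h' h'' => hu p q (by omega) h' (by omega))
      (fun p q h h' h'' => hv p q (by omega) h' (by omega))
    rw [h2, Finset.sum_range_add, Finset.sum_range_add]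
    simp only [← add_assoc]
    set S := ∑ p ∈ Finset.range (2 ^ k), a (o + p) with hS
    set T := ∑ p ∈ Finset.range (2 ^ k), a (o + 2 ^ k + p) with hT
    -- The two halves are separated by the last `b` of the first half: it has product at least `u`
    -- with every `a` of that half and at most `v` with every `a` of the other. The parallelogram
    -- law turns this into a gain at each doubling.
    have hST : 2 ^ k * (u - v) ≤ ‖S - T‖ := by
      have h1 : ⟪S - T, b (o + (2 ^ k - 1))⟫ ≤ ‖S - T‖ :=
        (real_inner_le_norm _ _).trans (mul_le_of_le_one_right (norm_nonneg _) (hb _))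
      refine le_trans ?_ h1
      rw [inner_sub_left, hS, hT, sum_inner, sum_inner]
      have hSu : 2 ^ k * u ≤ ∑ p ∈ Finset.range (2 ^ k), ⟪a (o + p), b (o + (2 ^ k - 1))⟫ := by
        have := Finset.card_nsmul_le_sum (Finset.range (2 ^ k))
          (fun p => ⟪a (o + p), b (o + (2 ^ k - 1))⟫) u fun p hp => by
            have := Finset.mem_range.mp hp
            exact hu _ _ (by omega) (by omega) (by omega)
        simpa using this
      have hTv : ∑ p ∈ Finset.range (2 ^ k), ⟪a (o + 2 ^ k + p), b (o + (2 ^ k - 1))⟫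
          ≤ 2 ^ k * v := by
        have := Finset.sum_le_card_nsmul (Finset.range (2 ^ k))
          (fun p => ⟪a (o + 2 ^ k + p), b (o + (2 ^ k - 1))⟫) v fun p hp => by
            have := Finset.mem_range.mp hp
            exact hv _ _ (by omega) (by omega) (by omega)
        simpa using this
      linarith
    have hsq : (2 ^ k * (u - v)) ^ 2 ≤ ‖S - T‖ ^ 2 :=
      pow_le_pow_left₀ (mul_nonneg (by positivity) (by linarith)) hST 2
    have hpar := parallelogram_law_with_norm ℝ S T
    have h4 : (4 : ℝ) ^ k = (2 ^ k) ^ 2 := by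
      rw [← pow_mul, mul_comm, pow_mul]; norm_num
    rw [pow_succ 4 k, pow_succ 2 k, h4]
    rw [h4] at hL hR
    push_cast
    nlinarith [hL, hR, hpar, hsq]

/-- If the probabilities `μ (A p ∩ B q)` are at least `u` for `p ≤ q` and at most `v` for `q < p`,
then `u` is hardly larger than `v`. -/
theorem sub_le_of_measureReal_inter_halfGraph {Ω : Type*} [MeasurableSpace Ω] {μ : Measure Ω}
    [IsProbabilityMeasure μ] {A B : ℕ → Set Ω} (hA : ∀ p, MeasurableSet (A p))
    (hB : ∀ q, MeasurableSet (B q)) {u v η : ℝ} {k : ℕ} (hη : 0 < η) (hk : 4 < k * η ^ 2)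
    (hu : ∀ p q, p ≤ q → q < 2 ^ k → u ≤ μ.real (A p ∩ B q))
    (hv : ∀ p q, q < p → p < 2 ^ k → μ.real (A p ∩ B q) ≤ v) : u - v ≤ η := by
  by_contra! hlt
  have hnorm : ∀ {s : Set Ω} (hs : MeasurableSet s),
      ‖indicatorConstLp 2 hs (measure_ne_top μ s) (1 : ℝ)‖ ≤ 1 := by
    intro s hs
    rw [norm_indicatorConstLp (by norm_num) (by norm_num), norm_one, one_mul]
    exact Real.rpow_le_one measureReal_nonneg measureReal_le_one (by norm_num)
  have h := sq_norm_sum_add_le_of_inner_halfGraph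
    (a := fun p => indicatorConstLp 2 (hA p) (measure_ne_top μ _) (1 : ℝ))
    (b := fun q => indicatorConstLp 2 (hB q) (measure_ne_top μ _) (1 : ℝ))
    (u := u) (v := v) (by linarith) (fun q => hnorm (hB q)) k 0
    (fun p q _ h h' => by
      rw [L2.real_inner_indicatorConstLp_one_indicatorConstLp_one]
      exact hu p q h (by omega))
    (fun p q _ h h' => by
      rw [L2.real_inner_indicatorConstLp_one_indicatorConstLp_one]
      exact hv p q h (by omega))
  have hsum : ∑ p ∈ Finset.range (2 ^ k),
      ‖indicatorConstLp 2 (hA (0 + p)) (measure_ne_top μ _) (1 : ℝ)‖ ^ 2 ≤ 2 ^ k := by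
    refine (Finset.sum_le_card_nsmul _ _ 1 fun p _ => ?_).trans (by simp)
    exact pow_le_one₀ (norm_nonneg _) (hnorm _)
  have h4 : (4 : ℝ) ^ k = 2 ^ k * 2 ^ k := by rw [← mul_pow]; norm_num
  have hpos : (0 : ℝ) < 4 ^ k := by positivity
  -- Indicators have norm at most `1`, so the total energy is at most `4 ^ k`; the `k` gains then
  -- force `k * (u - v) ^ 2 ≤ 4`.
  have h1 : k * (u - v) ^ 2 / 4 * (4 : ℝ) ^ k ≤ 1 * 4 ^ k := by
    have := mul_le_mul_of_nonneg_left hsum (by positivity : (0 : ℝ) ≤ 2 ^ k)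
    rw [one_mul]
    refine le_trans (le_trans (le_add_of_nonneg_left (sq_nonneg _)) h) (this.trans h4.ge)
  have h2 := le_of_mul_le_mul_right h1 hpos
  have h3 : (k : ℝ) * η ^ 2 ≤ k * (u - v) ^ 2 := by gcongr
  linarith

/-! ### Measurability, silenced executions and first replies -/

instance CommRound.instCountable {n : ℕ} {M : Type*} [Countable M] : Countable (CommRound n M) :=
  Function.Injective.countable (f := fun ρ : CommRound n M => (ρ.broadcast, ρ.unicast, ρ.reply))
    fun ρ σ h => by
      cases ρ
      cases σ
      simpa using h

namespace MonitoringAlgorithm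

variable {n : ℕ} {D M Ω : Type*} [MeasurableSpace Ω]

theorem measurableSet_step_eq (A : MonitoringAlgorithm n D M Ω) (x : Fin n → D)
    (h : List (CommRound n M)) (ρ : CommRound n M) : MeasurableSet {ω | A.step ω x h = ρ} := by
  -- On this event the messages received by the nodes are those of `ρ`, so each response is
  -- evaluated at fixed arguments, where measurability is assumed.
  have : {ω | A.step ω x h = ρ} = {ω | A.broadcast ω h = ρ.broadcast} ∩
      ((⋂ i, {ω | A.unicast ω h i = ρ.unicast i}) ∩ ⋂ i, {ω | A.respond ω i (x i)
        (h.map fun ρ => ρ.view i) ρ.broadcast (ρ.unicast i) = ρ.reply i}) := by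
    ext ω
    simp only [Set.mem_ofPred_eq, Set.mem_inter_iff, Set.mem_iInter]
    constructor
    · rintro rfl
      exact ⟨rfl, fun _ => rfl, fun _ => rfl⟩
    · rintro ⟨hb, hu, hr⟩
      cases ρ
      simp only [step, CommRound.mk.injEq] at *
      refine ⟨hb, funext hu, funext fun i => ?_⟩
      rw [hb, hu, hr]
  rw [this]
  exact (A.measurableSet_broadcast _ _).inter
    ((MeasurableSet.iInter fun i => A.measurableSet_unicast _ _ _).inter
      (MeasurableSet.iInter fun i => A.measurableSet_respond _ _ _ _ _ _))

theorem measurableSet_history_eq [Countable M] (A : MonitoringAlgorithm n D M Ω) (x : Fin n → D)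
    (r : ℕ) : ∀ h, MeasurableSet {ω | A.history ω x r = h} := by
  induction r with
  | zero => intro h; exact MeasurableSet.const ([] = h)
  | succ r ih =>
    intro h
    have : {ω | A.history ω x (r + 1) = h} =
        ⋃ g, {ω | A.history ω x r = g} ∩ ⋃ ρ, {ω | A.step ω x g = ρ} ∩ {_ω | ρ :: g = h} := by
      ext ω
      simp [history]
    rw [this]
    exact MeasurableSet.iUnion fun g => (ih g).inter <| MeasurableSet.iUnion fun ρ =>
      (A.measurableSet_step_eq x g ρ).inter (MeasurableSet.const _)

theorem measurableSet_setOf_history [Countable M] (A : MonitoringAlgorithm n D M Ω) (x : Fin n → D)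
    (r : ℕ) {P : Ω → List (CommRound n M) → Prop} (hP : ∀ h, MeasurableSet {ω | P ω h}) :
    MeasurableSet {ω | P ω (A.history ω x r)} := by
  have : {ω | P ω (A.history ω x r)} = ⋃ h, {ω | A.history ω x r = h} ∩ {ω | P ω h} := by
    ext ω
    simp
  rw [this]
  exact MeasurableSet.iUnion fun h => (A.measurableSet_history_eq x r h).inter (hP h)

/-- The algorithm in which the nodes of `T` never send anything. -/
def silence (A : MonitoringAlgorithm n D M Ω) (T : Finset (Fin n)) :
    MonitoringAlgorithm n D M Ω where
  rounds := A.rounds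
  broadcast := A.broadcast
  unicast := A.unicast
  respond ω i d v b u := if i ∈ T then none else A.respond ω i d v b u
  output := A.output
  measurableSet_broadcast := A.measurableSet_broadcast
  measurableSet_unicast := A.measurableSet_unicast
  measurableSet_respond i d v b u m := by
    split_ifs
    · exact MeasurableSet.const _
    · exact A.measurableSet_respond i d v b u m
  measurableSet_output := A.measurableSet_output

/-- Given that the nodes of `T` sent nothing in the first `r` rounds, node `i` with item `d` would
send a message in the next round. -/
def Speaks (A : MonitoringAlgorithm n D M Ω) (T : Finset (Fin n)) (ω : Ω) (x : Fin n → D) (r : ℕ)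
    (i : Fin n) (d : D) : Prop :=
  A.respond ω i d (((A.silence T).history ω x r).map fun ρ => ρ.view i)
    (A.broadcast ω ((A.silence T).history ω x r))
    (A.unicast ω ((A.silence T).history ω x r) i) ≠ none

/-- The event that node `j` sends a message after `t` rounds in which all nodes of `T` were
silent. -/
def firstReply (A : MonitoringAlgorithm n D M Ω) (T : Finset (Fin n)) (x : Fin n → D) (j : Fin n)
    (t : ℕ) : Set Ω :=
  {ω | A.Speaks T ω x t j (x j) ∧ ∀ r < t, ∀ l ∈ T, ¬ A.Speaks T ω x r l (x l)}

/-- Items influence an execution only through the replies of their holders, and those of `T` are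
suppressed. -/
theorem silence_history_congr (A : MonitoringAlgorithm n D M Ω) {T : Finset (Fin n)}
    {x y : Fin n → D} (hxy : ∀ l, l ∉ T → x l = y l) (ω : Ω) (r : ℕ) :
    (A.silence T).history ω x r = (A.silence T).history ω y r := by
  induction r with
  | zero => rfl
  | succ r ih =>
    simp only [history, ih, List.cons.injEq, and_true]
    simp only [step, silence, CommRound.mk.injEq, true_and]
    funext i
    split_ifs with hi
    · rfl
    · rw [hxy i hi]

theorem speaks_congr (A : MonitoringAlgorithm n D M Ω) {T : Finset (Fin n)}
    {x y : Fin n → D} (hxy : ∀ l, l ∉ T → x l = y l) (ω : Ω) (r : ℕ) (i : Fin n) (d : D) :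
    A.Speaks T ω x r i d ↔ A.Speaks T ω y r i d := by
  simp only [Speaks, A.silence_history_congr hxy]

theorem silence_result_congr (A : MonitoringAlgorithm n D M Ω) {T : Finset (Fin n)}
    {x y : Fin n → D} (hxy : ∀ l, l ∉ T → x l = y l) (ω : Ω) :
    (A.silence T).result ω x = (A.silence T).result ω y := by
  simp only [result, A.silence_history_congr hxy]

theorem history_eq_silence_history (A : MonitoringAlgorithm n D M Ω) {T : Finset (Fin n)}
    {x : Fin n → D} {ω : Ω} {t : ℕ} (h : ∀ r < t, ∀ l ∈ T, ¬ A.Speaks T ω x r l (x l)) :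
    A.history ω x t = (A.silence T).history ω x t := by
  induction t with
  | zero => rfl
  | succ t ih =>
    have ih' := ih fun r hr => h r (by omega)
    simp only [history, ih', List.cons.injEq, and_true]
    simp only [step, silence, CommRound.mk.injEq, true_and]
    funext i
    split_ifs with hi
    · exact not_not.mp (h t (by omega) i hi)
    · rfl

theorem reply_ne_none_of_mem_firstReply (A : MonitoringAlgorithm n D M Ω) {T : Finset (Fin n)}
    {x : Fin n → D} {ω : Ω} {j : Fin n} {t : ℕ} (h : ω ∈ A.firstReply T x j t) :
    (A.step ω x (A.history ω x t)).reply j ≠ none := by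
  rw [A.history_eq_silence_history h.2]
  exact h.1

theorem messages_eq_sum (A : MonitoringAlgorithm n D M Ω) (ω : Ω) (x : Fin n → D) :
    A.messages ω x = ∑ r ∈ Finset.range A.rounds, (A.step ω x (A.history ω x r)).cost := by
  have : ∀ R, ((A.history ω x R).map CommRound.cost).sum =
      ∑ r ∈ Finset.range R, (A.step ω x (A.history ω x r)).cost := by
    intro R
    induction R with
    | zero => rfl
    | succ R ih => rw [Finset.sum_range_succ, ← ih, history, List.map_cons, List.sum_cons, add_comm]
  exact this _

/-- Look at the first round in which some node of `T` would speak; if there is none, the true and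
the silenced executions coincide. -/
theorem exists_firstReply_or_silence_result_eq (A : MonitoringAlgorithm n D M Ω)
    (T : Finset (Fin n)) (x : Fin n → D) (ω : Ω) :
    (∃ j ∈ T, ∃ t < A.rounds, ω ∈ A.firstReply T x j t) ∨
      (A.silence T).result ω x = A.result ω x := by
  classical
  by_cases h : ∃ r, r < A.rounds ∧ ∃ l ∈ T, A.Speaks T ω x r l (x l)
  · obtain ⟨hr, l, hl, hs⟩ := Nat.find_spec h
    refine Or.inl ⟨l, hl, Nat.find h, hr, hs, fun r hrt l' hl' hs' => ?_⟩
    exact Nat.find_min h hrt ⟨hrt.trans hr, l', hl', hs'⟩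
  · push Not at h
    refine Or.inr ?_
    simp only [result]
    rw [A.history_eq_silence_history h]
    rfl

theorem measurableSet_speaks [Countable M] (A : MonitoringAlgorithm n D M Ω) (T : Finset (Fin n))
    (x : Fin n → D) (r : ℕ) (i : Fin n) (d : D) : MeasurableSet {ω | A.Speaks T ω x r i d} := by
  refine (A.silence T).measurableSet_setOf_history x r (P := fun ω h =>
    A.respond ω i d (h.map fun ρ => ρ.view i) (A.broadcast ω h) (A.unicast ω h i) ≠ none)
    fun h => ?_
  have : {ω | A.respond ω i d (h.map fun ρ => ρ.view i) (A.broadcast ω h) (A.unicast ω h i) ≠ none}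
      = ⋃ b, {ω | A.broadcast ω h = b} ∩ ⋃ u, {ω | A.unicast ω h i = u} ∩
        {ω | A.respond ω i d (h.map fun ρ => ρ.view i) b u = none}ᶜ := by
    ext ω
    simp
  rw [this]
  exact MeasurableSet.iUnion fun b => (A.measurableSet_broadcast h b).inter <|
    MeasurableSet.iUnion fun u => (A.measurableSet_unicast h i u).inter
      (A.measurableSet_respond _ _ _ _ _ _).compl

theorem measurableSet_forall_not_speaks [Countable M] (A : MonitoringAlgorithm n D M Ω)
    (T T' : Finset (Fin n)) (x : Fin n → D) (t : ℕ) (d : Fin n → D) :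
    MeasurableSet {ω | ∀ r < t, ∀ l ∈ T', ¬ A.Speaks T ω x r l (d l)} := by
  simp only [Set.ofPred_forall]
  exact MeasurableSet.iInter fun r => MeasurableSet.iInter fun _ => MeasurableSet.iInter fun l =>
    MeasurableSet.iInter fun _ => (A.measurableSet_speaks T x r l (d l)).compl

theorem measurableSet_firstReply [Countable M] (A : MonitoringAlgorithm n D M Ω) (T : Finset (Fin n))
    (x : Fin n → D) (j : Fin n) (t : ℕ) : MeasurableSet (A.firstReply T x j t) :=
  (A.measurableSet_speaks T x t j (x j)).inter (A.measurableSet_forall_not_speaks T T x t x)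

theorem measurableSet_result_eq [Countable M] (A : MonitoringAlgorithm n D M Ω) (x : Fin n → D)
    (d : D) : MeasurableSet {ω | A.result ω x = d} :=
  A.measurableSet_setOf_history x A.rounds (P := fun ω h => A.output ω h = d)
    fun h => A.measurableSet_output h d

/-- Every node contributes to the expected number of messages at least the probability that it is
among the first speakers of some group of nodes. -/
theorem sum_measure_firstReply_le_lintegral_messages [Countable M] (A : MonitoringAlgorithm n D M Ω)
    (μ : Measure Ω) (T : Fin n → Finset (Fin n)) (x : Fin n → D) :
    ∑ j, ∑ t ∈ Finset.range A.rounds, μ (A.firstReply (T j) x j t)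
      ≤ ∫⁻ ω, (A.messages ω x : ENNReal) ∂μ := by
  classical
  have hle : ∀ ω, ∑ j, ∑ t ∈ Finset.range A.rounds,
      (A.firstReply (T j) x j t).indicator (fun _ => (1 : ENNReal)) ω
        ≤ (A.messages ω x : ENNReal) := by
    intro ω
    -- Compare round by round: a first reply of `j` relative to any group is a real reply of `j` in
    -- that round, so the groups may vary with `j` without any message being counted twice.
    rw [Finset.sum_comm, A.messages_eq_sum, Nat.cast_sum]
    refine Finset.sum_le_sum fun t _ => ?_
    calc ∑ j, (A.firstReply (T j) x j t).indicator (fun _ => (1 : ENNReal)) ω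
        ≤ ∑ j, if ((A.step ω x (A.history ω x t)).reply j).isSome = true then (1 : ENNReal)
            else 0 := by
          refine Finset.sum_le_sum fun j _ => ?_
          by_cases h : ω ∈ A.firstReply (T j) x j t
          · rw [if_pos (Option.isSome_iff_ne_none.mpr (A.reply_ne_none_of_mem_firstReply h)),
              Set.indicator_of_mem h]
          · rw [Set.indicator_of_notMem h]
            exact zero_le
      _ = (((Finset.univ.filter fun i =>
            ((A.step ω x (A.history ω x t)).reply i).isSome = true).card : ℕ) : ENNReal) := by
          rw [Finset.sum_boole]
      _ ≤ _ := by
          rw [CommRound.cost]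
          exact_mod_cast Nat.le_add_left _ _
  calc ∑ j, ∑ t ∈ Finset.range A.rounds, μ (A.firstReply (T j) x j t)
      = ∫⁻ ω, ∑ j, ∑ t ∈ Finset.range A.rounds,
          (A.firstReply (T j) x j t).indicator (fun _ => (1 : ENNReal)) ω ∂μ := by
        have hm : ∀ j t, Measurable
            ((A.firstReply (T j) x j t).indicator (fun _ => (1 : ENNReal))) := fun j t =>
          measurable_const.indicator (A.measurableSet_firstReply _ _ _ _)
        rw [lintegral_finsetSum _ fun j _ => Finset.measurable_fun_sum _ fun t _ => hm j t]
        refine Finset.sum_congr rfl fun j _ => ?_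
        rw [lintegral_finsetSum _ fun t _ => hm j t]
        refine Finset.sum_congr rfl fun t _ => ?_
        rw [lintegral_indicator (A.measurableSet_firstReply _ _ _ _), setLIntegral_one]
    _ ≤ _ := lintegral_mono hle

/-- If all items of rank at most `L` are held by nodes of `T`, then a successful algorithm makes
some node of `T` speak, or guesses an item of such a node. -/
theorem measureReal_isItemOfRankAtMost_le [LinearOrder D] (A : MonitoringAlgorithm n D M Ω)
    (μ : Measure Ω) [IsProbabilityMeasure μ] (T : Finset (Fin n)) (x : Fin n → D) {L : ℝ}
    (hT : ∀ l, (dataRank x (x l) : ℝ) ≤ L → l ∈ T) :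
    μ.real {ω | IsItemOfRankAtMost x L (A.result ω x)} ≤
      ∑ j ∈ T, ∑ t ∈ Finset.range A.rounds, μ.real (A.firstReply T x j t)
        + ∑ l ∈ T, μ.real {ω | (A.silence T).result ω x = x l} := by
  have hsub : {ω | IsItemOfRankAtMost x L (A.result ω x)} ⊆
      (⋃ j ∈ T, ⋃ t ∈ Finset.range A.rounds, A.firstReply T x j t) ∪
        ⋃ l ∈ T, {ω | (A.silence T).result ω x = x l} := by
    rintro ω ⟨⟨l, hl⟩, hrank⟩
    rcases A.exists_firstReply_or_silence_result_eq T x ω with ⟨j, hj, t, ht, h⟩ | h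
    · left
      simp only [Set.mem_iUnion]
      exact ⟨j, hj, t, Finset.mem_range.mpr ht, h⟩
    · right
      simp only [Set.mem_iUnion]
      exact ⟨l, hT l (by rwa [hl]), h.trans hl.symm⟩
  -- Monotonicity and the union bound hold for outer measures, so the success event need not be
  -- measurable.
  refine (measureReal_mono hsub).trans ((measureReal_union_le _ _).trans (add_le_add ?_ ?_))
  · refine (measureReal_biUnion_finset_le _ _).trans (Finset.sum_le_sum fun j _ => ?_)
    exact measureReal_biUnion_finset_le _ _
  · exact measureReal_biUnion_finset_le _ _

end MonitoringAlgorithm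

/-! ### Exchanging two silent items, and guessing a silent item -/

namespace MonitoringAlgorithm

variable {n : ℕ} {D M Ω : Type*} [MeasurableSpace Ω]

/-- The silenced history is unaffected by `z` and `w`, so `w` matters only through the silence of
`j'` and `z` only through the behaviour of `j`. This product structure is what the half graph bound
needs. -/
theorem firstReply_update (A : MonitoringAlgorithm n D M Ω) {T : Finset (Fin n)} {j j' : Fin n}
    (hjj : j ≠ j') (hj : j ∈ T) (hj' : j' ∈ T) (x : Fin n → D) (z w : D) (t : ℕ) :
    A.firstReply T (Function.update (Function.update x j z) j' w) j t =
      {ω | A.Speaks T ω x t j z ∧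
        ∀ r < t, ∀ l ∈ T.erase j', ¬ A.Speaks T ω x r l (Function.update x j z l)} ∩
      {ω | ∀ r < t, ∀ l ∈ ({j'} : Finset (Fin n)), ¬ A.Speaks T ω x r l w} := by
  have hx : ∀ l, l ∉ T → Function.update (Function.update x j z) j' w l = x l := fun l hl => by
    rw [Function.update_of_ne (by rintro rfl; exact hl hj'),
      Function.update_of_ne (by rintro rfl; exact hl hj)]
  ext ω
  simp only [firstReply, Set.mem_ofPred_eq, Set.mem_inter_iff, A.speaks_congr hx,
    Function.update_of_ne hjj, Function.update_self, Finset.mem_singleton, forall_eq]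
  constructor
  · rintro ⟨h1, h2⟩
    refine ⟨⟨h1, fun r hr l hl => ?_⟩, fun r hr => ?_⟩
    · have := h2 r hr l (Finset.mem_of_mem_erase hl)
      rwa [Function.update_of_ne (Finset.ne_of_mem_erase hl)] at this
    · simpa using h2 r hr j' hj'
  · rintro ⟨⟨h1, h2⟩, h3⟩
    refine ⟨h1, fun r hr l hl => ?_⟩
    by_cases h : l = j'
    · subst h
      simpa using h3 r hr
    · rw [Function.update_of_ne h]
      exact h2 r hr l (Finset.mem_erase.mpr ⟨h, hl⟩)

/-- If the probability that `j` is among the first speakers of `T` depends (almost) only on the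
order of the items `z p` of `j` and `w q` of `j'`, then it hardly depends on this order. -/
theorem sub_le_of_measureReal_firstReply_update [Countable M] (A : MonitoringAlgorithm n D M Ω)
    (μ : Measure Ω) [IsProbabilityMeasure μ] {T : Finset (Fin n)} {j j' : Fin n}
    (hjj : j ≠ j') (hj : j ∈ T) (hj' : j' ∈ T) (x : Fin n → D) (z w : ℕ → D) (t : ℕ)
    {u v η : ℝ} {k : ℕ} (hη : 0 < η) (hk : 4 < k * η ^ 2)
    (hu : ∀ p q, p ≤ q → q < 2 ^ k →
      u ≤ μ.real (A.firstReply T (Function.update (Function.update x j (z p)) j' (w q)) j t))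
    (hv : ∀ p q, q < p → p < 2 ^ k →
      μ.real (A.firstReply T (Function.update (Function.update x j (z p)) j' (w q)) j t) ≤ v) :
    u - v ≤ η := by
  simp only [A.firstReply_update hjj hj hj'] at hu hv
  exact sub_le_of_measureReal_inter_halfGraph
    (fun p => (A.measurableSet_speaks T x t j (z p)).inter
      (A.measurableSet_forall_not_speaks T (T.erase j') x t (Function.update x j (z p))))
    (fun q => A.measurableSet_forall_not_speaks T {j'} x t fun _ => w q) hη hk hu hv

/-- The silenced server cannot guess an item of a silent node that may be any of many items. -/
theorem measureReal_silence_result_eq_le [Countable M] (A : MonitoringAlgorithm n D M Ω)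
    (μ : Measure Ω) [IsProbabilityMeasure μ] {T : Finset (Fin n)} {j : Fin n} (hj : j ∈ T)
    (x : Fin n → D) {K : ℕ} (hK : 0 < K) {z : ℕ → D} (hz : Set.InjOn z (Set.Iio K)) {u : ℝ}
    (hu : ∀ p < K, u ≤ μ.real {ω | (A.silence T).result ω (Function.update x j (z p)) = z p}) :
    u ≤ 1 / K := by
  have hx : ∀ p l, l ∉ T → Function.update x j (z p) l = x l := fun p l hl => by
    rw [Function.update_of_ne (by rintro rfl; exact hl hj)]
  simp only [fun p => A.silence_result_congr (hx p)] at hu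
  -- The silenced output is the same random variable for all `p`, and it cannot equal two different
  -- candidates.
  have hdisj : Set.PairwiseDisjoint (Finset.range K : Set ℕ)
      fun p => {ω | (A.silence T).result ω x = z p} := by
    intro p hp q hq hpq
    refine Set.disjoint_left.mpr fun ω (h : _ = _) (h' : _ = _) => hpq ?_
    exact hz (by simpa using hp) (by simpa using hq) (h.symm.trans h')
  have h1 := measureReal_biUnion_finset (μ := μ) hdisj
    fun p _ => (A.silence T).measurableSet_result_eq x (z p)
  have h2 := Finset.card_nsmul_le_sum (Finset.range K) _ u fun p hp => hu p (Finset.mem_range.mp hp)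
  rw [← h1, Finset.card_range, nsmul_eq_mul] at h2
  rw [le_div_iff₀ (by exact_mod_cast hK), mul_comm]
  exact h2.trans measureReal_le_one

end MonitoringAlgorithm

/-! ### Inputs on which the algorithm is almost order-oblivious -/

/-- The positions `K * l`, except that the entries `i` and `i'` are `a` and `b`. -/
def perturbedPositions {n : ℕ} (K : ℕ) (i i' : Fin n) (a b : ℕ) (l : Fin n) : ℕ :=
  if l = i then a else if l = i' then b else K * l

theorem perturbedPositions_lt {n K a b : ℕ} {i i' : Fin n} (hK : 0 < K)
    (ha' : a < K * i + K) (hb' : b < K * i + K) (l : Fin n) :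
    perturbedPositions K i i' a b l < K * n := by
  have h : ∀ l : Fin n, K * l + K ≤ K * n := fun l => by
    have := Nat.mul_le_mul_left K l.isLt
    rwa [Nat.succ_eq_add_one, mul_add, mul_one] at this
  have h1 := h i
  have h2 := h l
  unfold perturbedPositions
  split_ifs <;> omega

theorem perturbedPositions_strictMono {n K a b : ℕ} {i i' : Fin n} (hK : 0 < K)
    (hi : (i' : ℕ) = i + 1) (ha : K * i ≤ a) (hab : a < b) (hb : b < K * i + K) :
    StrictMono (perturbedPositions K i i' a b) := by
  have h : ∀ l m : ℕ, l < m → K * l + K ≤ K * m := fun l m hlm => by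
    have := Nat.mul_le_mul_left K hlm
    rwa [Nat.succ_eq_add_one, mul_add, mul_one] at this
  intro l m hlm
  have hlm' : (l : ℕ) < m := hlm
  have h0 := h l m hlm'
  have h1 := h l i
  have h2 := h i m
  unfold perturbedPositions
  split_ifs <;> simp only [Fin.ext_iff] at * <;> omega

theorem perturbedPositions_self_strictMono {n K a b : ℕ} {i : Fin n} (hK : 0 < K)
    (ha : K * i ≤ a) (ha' : a < K * i + K) : StrictMono (perturbedPositions K i i a b) := by
  have h : ∀ l m : ℕ, l < m → K * l + K ≤ K * m := fun l m hlm => by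
    have := Nat.mul_le_mul_left K hlm
    rwa [Nat.succ_eq_add_one, mul_add, mul_one] at this
  intro l m hlm
  have hlm' : (l : ℕ) < m := hlm
  have h0 := h l m hlm'
  unfold perturbedPositions
  split_ifs with c1 c2 c3 <;> simp only [Fin.ext_iff] at *
  · omega
  · rw [c1] at h0; omega
  · rw [c3] at h0; omega
  · omega

open MonitoringAlgorithm in
/-- There are data items on which the algorithm is almost oblivious to the order of the items that
are adjacent and both belong to a silent group, and for which the server cannot guess an item of a
silent group. -/
theorem exists_almost_order_oblivious {n : ℕ} {D M Ω : Type*} [LinearOrder D] [Infinite D]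
    [Countable M] [MeasurableSpace Ω] (μ : Measure Ω) [IsProbabilityMeasure μ]
    (A : MonitoringAlgorithm n D M Ω) {η : ℝ} (hη : 0 < η) :
    ∃ y : Fin n → D, StrictMono y ∧
      (∀ (π : Equiv.Perm (Fin n)) (T : Finset (Fin n)), ∀ t < A.rounds, ∀ i i' : Fin n,
        (i' : ℕ) = i + 1 → π.symm i ∈ T → π.symm i' ∈ T →
        μ.real (A.firstReply T (y ∘ π) (π.symm i) t) ≤
          μ.real (A.firstReply T (y ∘ π.trans (Equiv.swap i i')) (π.symm i) t) + η) ∧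
      ∀ (π : Equiv.Perm (Fin n)), ∀ T : Finset (Fin n), ∀ j ∈ T,
        μ.real {ω | (A.silence T).result ω (y ∘ π) = y (π j)} ≤ η := by
  -- The first summand gives a half graph gap of at most `η / 2`, the second makes the guessing
  -- probability `1 / K` at most `η / 2`. Ramsey errors of `η / 4` fit into the remaining `η / 2`:
  -- two for an exchange, one for a guess.
  obtain ⟨k, hk⟩ := exists_nat_gt (4 / (η / 2) ^ 2 + 2 / η)
  have hk1 : 4 < k * (η / 2) ^ 2 := by
    rw [← div_lt_iff₀ (by positivity)]
    exact lt_of_le_of_lt (le_add_of_nonneg_right (by positivity)) hk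
  have hk2 : 2 / η < k := lt_of_le_of_lt (le_add_of_nonneg_left (by positivity)) hk
  obtain ⟨K, hK⟩ : ∃ K, K = 2 * 2 ^ k := ⟨_, rfl⟩
  have hK0 : 0 < K := by rw [hK]; positivity
  have hkK : (k : ℝ) ≤ K := by
    have : k < 2 ^ k := Nat.lt_two_pow_self
    exact_mod_cast (by omega : k ≤ K)
  let Φ : (Equiv.Perm (Fin n) × Finset (Fin n) × Fin n × Fin A.rounds) ⊕
      (Equiv.Perm (Fin n) × Finset (Fin n) × Fin n) → (Fin n → D) → ℝ := fun c y =>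
    Sum.elim (fun c => μ.real (A.firstReply c.2.1 (y ∘ c.1) c.2.2.1 c.2.2.2))
      (fun c => μ.real {ω | (A.silence c.2.1).result ω (y ∘ c.1) = y (c.1 c.2.2)}) c
  obtain ⟨s, hs, hΦ⟩ := exists_strictMonoOn_almost_constant Φ
    (by rintro (c | c) y <;> exact measureReal_nonneg)
    (by rintro (c | c) y <;> exact measureReal_le_one)
    (ε := η / 4) (by positivity) (K * n)
  have hf₀ : StrictMono fun l : Fin n => K * (l : ℕ) := fun l m h =>
    Nat.mul_lt_mul_of_pos_left h hK0
  have hf₀N : ∀ l : Fin n, K * (l : ℕ) < K * n := fun l => Nat.mul_lt_mul_of_pos_left l.isLt hK0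
  refine ⟨fun l => s (K * l), fun l m h => hs (hf₀N l) (hf₀N m) (hf₀ h), ?_, ?_⟩
  · intro π T t ht i i' hi hiT hiT'
    have hne : i ≠ i' := fun h => by rw [h] at hi; omega
    have hjj : π.symm i ≠ π.symm i' := fun h => hne (π.symm.injective h)
    -- Both moving items lie in the block of length `K` that starts at `K * i`. Even offsets for one
    -- node and odd offsets for the other turn `p ≤ q` into a strict order and avoid ties.
    have key := A.sub_le_of_measureReal_firstReply_update μ hjj hiT hiT'
      ((fun l : Fin n => s (K * l)) ∘ π) (fun p => s (K * i + 2 * p))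
      (fun q => s (K * i + (2 * q + 1))) t (half_pos hη) hk1
      (u := μ.real (A.firstReply T ((fun l : Fin n => s (K * l)) ∘ π) (π.symm i) t) - η / 4)
      (v := μ.real (A.firstReply T ((fun l : Fin n => s (K * l)) ∘ π.trans (Equiv.swap i i'))
        (π.symm i) t) + η / 4) ?_ ?_
    · linarith
    · intro p q hpq hq
      have h := hΦ (Sum.inl (π, T, π.symm i, ⟨t, ht⟩)) _
        (perturbedPositions K i i' (K * i + 2 * p) (K * i + (2 * q + 1))) hf₀
        (perturbedPositions_strictMono hK0 hi (by omega) (by omega) (by omega)) hf₀N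
        (perturbedPositions_lt hK0 (by omega) (by omega))
      have he : (fun l => s (perturbedPositions K i i' (K * i + 2 * p) (K * i + (2 * q + 1)) l)) ∘ π
          = Function.update (Function.update ((fun l : Fin n => s (K * l)) ∘ π) (π.symm i)
            (s (K * i + 2 * p))) (π.symm i') (s (K * i + (2 * q + 1))) := by
        funext l
        simp only [Function.comp_apply, Function.update_apply, perturbedPositions,
          Equiv.eq_symm_apply]
        split_ifs with h1 h2 <;> first | rfl | exact absurd (h1.symm.trans h2) hne
      simp only [Φ, Sum.elim_inl, he] at h
      linarith
    · intro p q hqp hp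
      -- For `q < p` the two nodes have exchanged ranks, so the assignment composed with the swap is
      -- the one that describes the input.
      have h := hΦ (Sum.inl (π.trans (Equiv.swap i i'), T, π.symm i, ⟨t, ht⟩))
        (perturbedPositions K i i' (K * i + (2 * q + 1)) (K * i + 2 * p)) _
        (perturbedPositions_strictMono hK0 hi (by omega) (by omega) (by omega)) hf₀
        (perturbedPositions_lt hK0 (by omega) (by omega)) hf₀N
      have he : (fun l => s (perturbedPositions K i i' (K * i + (2 * q + 1)) (K * i + 2 * p) l)) ∘
            π.trans (Equiv.swap i i')
          = Function.update (Function.update ((fun l : Fin n => s (K * l)) ∘ π) (π.symm i)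
            (s (K * i + 2 * p))) (π.symm i') (s (K * i + (2 * q + 1))) := by
        funext l
        simp only [Function.comp_apply, Function.update_apply, perturbedPositions,
          Equiv.eq_symm_apply, Equiv.trans_apply]
        by_cases h1 : π l = i
        · simp [h1, hne, hne.symm]
        · by_cases h2 : π l = i'
          · simp [h2]
          · simp [Equiv.swap_apply_of_ne_of_ne h1 h2, h1, h2]
      simp only [Φ, Sum.elim_inl, he] at h
      exact h
  · intro π T j hj
    have key := A.measureReal_silence_result_eq_le μ hj ((fun l : Fin n => s (K * l)) ∘ π) hK0
      (z := fun p => s (K * (π j) + p))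
      (u := μ.real {ω | (A.silence T).result ω ((fun l : Fin n => s (K * l)) ∘ π) = s (K * (π j))}
        - η / 4) ?_ ?_
    · have : 1 / (K : ℝ) ≤ η / 2 := by
        rw [div_le_iff₀ (by exact_mod_cast hK0)]
        rw [div_lt_iff₀ hη] at hk2
        nlinarith
      linarith
    · intro p hp q hq hpq
      have hlt : ∀ p < K, K * (π j : ℕ) + p < K * n := fun p hp => by
        have := Nat.mul_le_mul_left K (π j).isLt
        rw [Nat.succ_eq_add_one, mul_add, mul_one] at this
        omega
      have := hs.injOn (hlt p hp) (hlt q hq) hpq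
      omega
    · intro p hp
      have h := hΦ (Sum.inr (π, T, j)) _
        -- With both indices equal only one entry moves, and the last argument `0` is never read.
        (perturbedPositions K (π j) (π j) (K * (π j) + p) 0) hf₀
        (perturbedPositions_self_strictMono hK0 (by omega) (by omega)) hf₀N
        (perturbedPositions_lt hK0 (by omega) (by omega))
      have he : (fun l => s (perturbedPositions K (π j) (π j) (K * (π j) + p) 0 l)) ∘ π
          = Function.update ((fun l : Fin n => s (K * l)) ∘ π) j (s (K * (π j) + p)) := by
        funext l
        simp only [Function.comp_apply, Function.update_apply, perturbedPositions,
          EmbeddingLike.apply_eq_iff_eq]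
        split_ifs <;> rfl
      simp only [Φ, Sum.elim_inr, he] at h
      simp only [perturbedPositions, if_true] at h
      linarith

/-! ### Averaging over the assignments of items to nodes -/

/-- The nodes that hold the `m` lowest items when node `l` holds the item of rank `π l + 1`. -/
def lowNodes {n : ℕ} (π : Equiv.Perm (Fin n)) (m : ℕ) : Finset (Fin n) :=
  Finset.univ.filter fun l => (π l : ℕ) < m

theorem mem_lowNodes {n : ℕ} {π : Equiv.Perm (Fin n)} {m : ℕ} {l : Fin n} :
    l ∈ lowNodes π m ↔ (π l : ℕ) < m := by
  simp [lowNodes]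

theorem sum_lowNodes {n : ℕ} (π : Equiv.Perm (Fin n)) (m : ℕ) (g : Fin n → ℝ) :
    ∑ j ∈ lowNodes π m, g j
      = ∑ i ∈ Finset.univ.filter (fun i : Fin n => (i : ℕ) < m), g (π.symm i) := by
  rw [lowNodes, Finset.sum_filter, Finset.sum_filter,
    ← Equiv.sum_comp π fun i => if (i : ℕ) < m then g (π.symm i) else 0]
  simp

theorem lowNodes_trans_swap {n : ℕ} (π : Equiv.Perm (Fin n)) {m : ℕ} {i i' : Fin n}
    (hi : (i : ℕ) < m) (hi' : (i' : ℕ) < m) :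
    lowNodes (π.trans (Equiv.swap i i')) m = lowNodes π m := by
  ext l
  rw [mem_lowNodes, mem_lowNodes, Equiv.trans_apply]
  by_cases h1 : π l = i
  · simp [h1, hi, hi']
  · by_cases h2 : π l = i'
    · simp [h2, hi, hi']
    · rw [Equiv.swap_apply_of_ne_of_ne h1 h2]

theorem dataRank_comp_perm {n : ℕ} {D : Type*} [LinearOrder D] {y : Fin n → D} (hy : StrictMono y)
    (π : Equiv.Perm (Fin n)) (l : Fin n) : dataRank (y ∘ π) ((y ∘ π) l) = π l + 1 := by
  have h : (Finset.univ.filter fun j => (y ∘ π) j ≤ (y ∘ π) l) = (Finset.Iic (π l)).map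
      π.symm.toEmbedding := by
    ext j
    simp [hy.le_iff_le]
  rw [dataRank, h, Finset.card_map, Fin.card_Iic]

namespace MonitoringAlgorithm

variable {n : ℕ} {D M Ω : Type*} [MeasurableSpace Ω]

/-- The probability that the node with the `i`-th lowest item is among the first speakers of the
holders of the `m` lowest items, summed over all assignments of the items `y` to the nodes. -/
noncomputable def firstReplySum (A : MonitoringAlgorithm n D M Ω) (μ : Measure Ω) (y : Fin n → D)
    (m : ℕ) (i : Fin n) : ℝ :=
  ∑ π : Equiv.Perm (Fin n), ∑ t ∈ Finset.range A.rounds,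
    μ.real (A.firstReply (lowNodes π m) (y ∘ π) (π.symm i) t)

/-- Composing with the swap permutes the assignments and preserves the group, so the sum for `i'`
can be rewritten with the same speaking node as the sum for `i`, after the exchange of items. -/
theorem firstReplySum_le_succ (A : MonitoringAlgorithm n D M Ω) (μ : Measure Ω) {y : Fin n → D}
    {η : ℝ} (hy : ∀ (π : Equiv.Perm (Fin n)) (T : Finset (Fin n)), ∀ t < A.rounds,
      ∀ i i' : Fin n, (i' : ℕ) = i + 1 → π.symm i ∈ T → π.symm i' ∈ T →
        μ.real (A.firstReply T (y ∘ π) (π.symm i) t) ≤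
          μ.real (A.firstReply T (y ∘ π.trans (Equiv.swap i i')) (π.symm i) t) + η)
    {m : ℕ} {i i' : Fin n} (hi : (i' : ℕ) = i + 1) (hm : (i' : ℕ) < m) :
    A.firstReplySum μ y m i ≤ A.firstReplySum μ y m i' + n.factorial * (A.rounds * η) := by
  have hperm : A.firstReplySum μ y m i' = ∑ π : Equiv.Perm (Fin n),
      ∑ t ∈ Finset.range A.rounds, μ.real (A.firstReply (lowNodes π m)
        (y ∘ π.trans (Equiv.swap i i')) (π.symm i) t) := by
    rw [firstReplySum, ← Equiv.sum_comp (Equiv.mulLeft (Equiv.swap i i'))]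
    refine Finset.sum_congr rfl fun π _ => Finset.sum_congr rfl fun t _ => ?_
    have h1 : Equiv.mulLeft (Equiv.swap i i') π = π.trans (Equiv.swap i i') := rfl
    rw [h1, lowNodes_trans_swap π (by omega) hm, Equiv.symm_trans_apply, Equiv.symm_swap,
      Equiv.swap_apply_right]
  have hc : ((n.factorial : ℕ) : ℝ) * (A.rounds * η) =
      ∑ _π : Equiv.Perm (Fin n), ∑ _t ∈ Finset.range A.rounds, η := by
    simp [Fintype.card_perm]
  rw [hperm, hc, firstReplySum, ← Finset.sum_add_distrib]
  refine Finset.sum_le_sum fun π _ => ?_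
  rw [← Finset.sum_add_distrib]
  refine Finset.sum_le_sum fun t ht => ?_
  exact hy π _ t (Finset.mem_range.mp ht) i i' hi
    (mem_lowNodes.mpr (by rw [Equiv.apply_symm_apply]; omega))
    (mem_lowNodes.mpr (by rwa [Equiv.apply_symm_apply]))

/-- Chain adjacent exchanges from `i` up to `i'`; there are at most `n` of them. -/
theorem firstReplySum_le (A : MonitoringAlgorithm n D M Ω) (μ : Measure Ω) {y : Fin n → D}
    {η : ℝ} (hη : 0 ≤ η) (hy : ∀ (π : Equiv.Perm (Fin n)) (T : Finset (Fin n)), ∀ t < A.rounds,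
      ∀ i i' : Fin n, (i' : ℕ) = i + 1 → π.symm i ∈ T → π.symm i' ∈ T →
        μ.real (A.firstReply T (y ∘ π) (π.symm i) t) ≤
          μ.real (A.firstReply T (y ∘ π.trans (Equiv.swap i i')) (π.symm i) t) + η)
    {m : ℕ} {i i' : Fin n} (hi : i ≤ i') (hm : (i' : ℕ) < m) :
    A.firstReplySum μ y m i
      ≤ A.firstReplySum μ y m i' + n * (n.factorial * (A.rounds * η)) := by
  have key : ∀ d : ℕ, ∀ i' : Fin n, (i' : ℕ) = i + d → (i' : ℕ) < m → A.firstReplySum μ y m i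
      ≤ A.firstReplySum μ y m i' + d * (n.factorial * (A.rounds * η)) := by
    intro d
    induction d with
    | zero =>
      intro i' hi' _
      rw [Fin.ext (hi'.trans (add_zero _))]
      simp
    | succ d ih =>
      intro i' hi' hm'
      have h1 := ih ⟨i + d, by omega⟩ rfl (by simp only; omega)
      have h2 := A.firstReplySum_le_succ μ hy (m := m) (i := ⟨i + d, by omega⟩) (i' := i')
        (by simp only; omega) hm'
      push_cast
      linarith
  refine (key (i' - i) i' (by have : (i : ℕ) ≤ i' := hi; omega) hm).trans ?_
  have : ((i' - i : ℕ) : ℝ) ≤ n := by exact_mod_cast (by omega : (i' - i : ℕ) ≤ n)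
  gcongr

/-- If the algorithm is successful and almost oblivious to the order of the items `y`, then the node
with the `i`-th lowest item is among the first speakers of the nodes with lower or equal items with
probability about `1 / (i + 1)`, on average over all assignments of the items to the nodes. -/
theorem factorial_div_le_firstReplySum [LinearOrder D] (A : MonitoringAlgorithm n D M Ω)
    (μ : Measure Ω) [IsProbabilityMeasure μ] {y : Fin n → D} (hmono : StrictMono y) {L η : ℝ}
    (hη : 0 ≤ η) (hη' : (n + n ^ 2 * A.rounds) * η ≤ 1 / 4)
    (hA : ∀ x : Fin n → D, Function.Injective x →
      3 / 4 ≤ μ.real {ω | IsItemOfRankAtMost x L (A.result ω x)})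
    (hy : ∀ (π : Equiv.Perm (Fin n)) (T : Finset (Fin n)), ∀ t < A.rounds,
      ∀ i i' : Fin n, (i' : ℕ) = i + 1 → π.symm i ∈ T → π.symm i' ∈ T →
        μ.real (A.firstReply T (y ∘ π) (π.symm i) t) ≤
          μ.real (A.firstReply T (y ∘ π.trans (Equiv.swap i i')) (π.symm i) t) + η)
    (hy' : ∀ (π : Equiv.Perm (Fin n)), ∀ T : Finset (Fin n), ∀ j ∈ T,
        μ.real {ω | (A.silence T).result ω (y ∘ π) = y (π j)} ≤ η)
    (i : Fin n) (hi : L ≤ i + 1) :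
    n.factorial * (1 / (2 * ((i : ℝ) + 1))) ≤ A.firstReplySum μ y (i + 1) i := by
  set S := Finset.univ.filter fun l : Fin n => (l : ℕ) < i + 1 with hS
  have hScard : S.card = i + 1 := by
    have : S = Finset.Iic i := by
      ext l
      simp only [hS, Finset.mem_filter, Finset.mem_univ, true_and, Finset.mem_Iic, Fin.le_def]
      omega
    rw [this, Fin.card_Iic]
  have h1 : ∀ π : Equiv.Perm (Fin n), 3 / 4 ≤ ∑ l ∈ S, ∑ t ∈ Finset.range A.rounds,
      μ.real (A.firstReply (lowNodes π (i + 1)) (y ∘ π) (π.symm l) t) + n * η := by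
    intro π
    refine (hA (y ∘ π) (hmono.injective.comp π.injective)).trans
      ((A.measureReal_isItemOfRankAtMost_le μ (lowNodes π (i + 1)) (y ∘ π) fun l hl => ?_).trans ?_)
    · rw [dataRank_comp_perm hmono] at hl
      rw [mem_lowNodes]
      have : (((π l : ℕ) + 1 : ℕ) : ℝ) ≤ ((i + 1 : ℕ) : ℝ) := by
        push_cast at hl ⊢
        linarith
      exact_mod_cast this
    · rw [sum_lowNodes]
      refine add_le_add le_rfl ?_
      refine (Finset.sum_le_card_nsmul _ _ η fun j hj => hy' π _ j hj).trans ?_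
      rw [nsmul_eq_mul]
      have : ((lowNodes π (i + 1)).card : ℝ) ≤ n := by
        exact_mod_cast (Finset.card_le_univ _).trans (Fintype.card_fin n).le
      gcongr
  have h2 : (n.factorial : ℝ) * (3 / 4) ≤
      ∑ l ∈ S, A.firstReplySum μ y (i + 1) l + n.factorial * (n * η) := by
    have := Finset.sum_le_sum fun π (_ : π ∈ Finset.univ) => h1 π
    rw [Finset.sum_add_distrib, Finset.sum_comm] at this
    simpa [Fintype.card_perm, firstReplySum] using this
  -- The top index `i` dominates each of the `i + 1` summands up to the error, so it has at least
  -- the average share.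
  have h3 : ∑ l ∈ S, A.firstReplySum μ y (i + 1) l ≤ ((i : ℝ) + 1) *
      (A.firstReplySum μ y (i + 1) i + n * (n.factorial * (A.rounds * η))) := by
    have := Finset.sum_le_card_nsmul S (fun l => A.firstReplySum μ y (i + 1) l) _ fun l hl =>
      A.firstReplySum_le μ hη hy (m := i + 1) (i := l) (i' := i)
        (by have := (Finset.mem_filter.mp hl).2; exact Fin.le_def.mpr (by omega)) (by omega)
    rw [hScard, nsmul_eq_mul] at this
    exact_mod_cast this
  have hin : (i : ℝ) + 1 ≤ n := by exact_mod_cast i.isLt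
  have h4 : ((i : ℝ) + 1) * (n * (n.factorial * (A.rounds * η))) ≤
      n.factorial * (n ^ 2 * A.rounds * η) := by
    calc ((i : ℝ) + 1) * (n * (n.factorial * (A.rounds * η)))
        ≤ n * (n * (n.factorial * (A.rounds * η))) := by gcongr
      _ = _ := by ring
  have h5 : (n.factorial : ℝ) * ((n + n ^ 2 * A.rounds) * η) ≤ n.factorial * (1 / 4) := by gcongr
  have hpos : (0 : ℝ) < (i : ℝ) + 1 := by positivity
  rw [← div_div, ← mul_div_assoc, div_le_iff₀ hpos]
  linarith

/-- Every node is measured against its own group, the holders of items up to its own. All ranks then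
contribute at once for the same assignment, and some assignment is at least as costly as the
average. -/
theorem exists_le_lintegral_messages [LinearOrder D] [Infinite D] [Countable M]
    (A : MonitoringAlgorithm n D M Ω) (μ : Measure Ω) [IsProbabilityMeasure μ] {L : ℝ}
    (hA : ∀ x : Fin n → D, Function.Injective x →
      3 / 4 ≤ μ.real {ω | IsItemOfRankAtMost x L (A.result ω x)}) :
    ∃ x : Fin n → D, Function.Injective x ∧
      ENNReal.ofReal (∑ i ∈ Finset.univ.filter (fun i : Fin n => L ≤ i + 1),
        1 / (2 * ((i : ℝ) + 1))) ≤ ∫⁻ ω, (A.messages ω x : ENNReal) ∂μ := by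
  -- Of the success probability `3 / 4`, guesses and exchange errors together consume at most `1 /
  -- 4`, leaving `1 / 2` to be shared.
  obtain ⟨η, hη, hη'⟩ : ∃ η : ℝ, 0 < η ∧ (n + n ^ 2 * A.rounds) * η ≤ 1 / 4 := by
    refine ⟨1 / 4 / (n + n ^ 2 * A.rounds + 1), by positivity, ?_⟩
    rw [← mul_div_assoc, div_le_iff₀ (by positivity)]
    linarith
  obtain ⟨y, hmono, hy, hy'⟩ := exists_almost_order_oblivious μ A hη
  set s := ∑ i ∈ Finset.univ.filter (fun i : Fin n => L ≤ i + 1), 1 / (2 * ((i : ℝ) + 1)) with hs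
  have hsum : n.factorial * s ≤ ∑ i : Fin n, A.firstReplySum μ y (i + 1) i := by
    rw [hs, Finset.mul_sum]
    refine (Finset.sum_le_sum fun i hi => A.factorial_div_le_firstReplySum μ hmono hη.le hη' hA
      hy hy' i (Finset.mem_filter.mp hi).2).trans ?_
    refine Finset.sum_le_sum_of_subset_of_nonneg (Finset.filter_subset _ _) fun i _ _ => ?_
    exact Finset.sum_nonneg fun π _ => Finset.sum_nonneg fun t _ => measureReal_nonneg
  have hreal : n.factorial * s ≤ ∑ π : Equiv.Perm (Fin n), ∑ j, ∑ t ∈ Finset.range A.rounds,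
      μ.real (A.firstReply (lowNodes π (π j + 1)) (y ∘ π) j t) := by
    refine hsum.trans_eq ?_
    simp only [firstReplySum]
    rw [Finset.sum_comm]
    refine Finset.sum_congr rfl fun π _ => ?_
    rw [← Equiv.sum_comp π]
    simp
  obtain ⟨π, -, hπ⟩ := Finset.exists_le_of_sum_le (s := (Finset.univ : Finset (Equiv.Perm (Fin n))))
    (f := fun _ => s) Finset.univ_nonempty
    (by simpa [Fintype.card_perm] using hreal)
  refine ⟨y ∘ π, hmono.injective.comp π.injective, le_trans ?_
    (A.sum_measure_firstReply_le_lintegral_messages μ (fun j => lowNodes π (π j + 1)) (y ∘ π))⟩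
  refine (ENNReal.ofReal_le_ofReal hπ).trans_eq ?_
  rw [ENNReal.ofReal_sum_of_nonneg fun j _ => Finset.sum_nonneg fun t _ => measureReal_nonneg]
  refine Finset.sum_congr rfl fun j _ => ?_
  rw [ENNReal.ofReal_sum_of_nonneg fun t _ => measureReal_nonneg]
  exact Finset.sum_congr rfl fun t _ => ofReal_measureReal

end MonitoringAlgorithm

/-! ### The harmonic sum and the choice of constants -/

theorem log_sub_le_sum_inv (n : ℕ) {L : ℝ} (hL : 1 ≤ L) (hn : 0 < n) :
    (Real.log n - 1 - Real.log L) / 2 ≤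
      ∑ i ∈ Finset.univ.filter (fun i : Fin n => L ≤ i + 1), 1 / (2 * ((i : ℝ) + 1)) := by
  have hharm : ∀ m : ℕ, (harmonic m : ℝ) = ∑ i ∈ Finset.range m, ((i : ℝ) + 1)⁻¹ := fun m => by
    simp [harmonic]
  have h1 : Real.log n ≤ ∑ i ∈ Finset.range n, ((i : ℝ) + 1)⁻¹ := by
    rw [← hharm]
    refine le_trans (Real.log_le_log (by exact_mod_cast hn) ?_) (log_add_one_le_harmonic n)
    push_cast
    linarith
  have h2 : ∑ i ∈ Finset.range ⌊L⌋₊, ((i : ℝ) + 1)⁻¹ ≤ 1 + Real.log L := by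
    rw [← hharm]
    exact harmonic_floor_le_one_add_log L hL
  have h3 : ∑ i ∈ (Finset.range n).filter (fun i : ℕ => ¬ L ≤ i + 1), ((i : ℝ) + 1)⁻¹ ≤
      ∑ i ∈ Finset.range ⌊L⌋₊, ((i : ℝ) + 1)⁻¹ := by
    refine Finset.sum_le_sum_of_subset_of_nonneg (fun i hi => ?_) fun i _ _ => by positivity
    have h := (Finset.mem_filter.mp hi).2
    rw [Finset.mem_range]
    refine Nat.lt_of_succ_le (Nat.le_floor ?_)
    push_cast
    linarith
  have h4 := Finset.sum_filter_add_sum_filter_not (Finset.range n) (fun i : ℕ => L ≤ (i : ℝ) + 1)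
    fun i => ((i : ℝ) + 1)⁻¹
  have h5 : ∑ i ∈ Finset.univ.filter (fun i : Fin n => L ≤ i + 1), 1 / (2 * ((i : ℝ) + 1)) =
      (∑ i ∈ (Finset.range n).filter (fun i : ℕ => L ≤ (i : ℝ) + 1), ((i : ℝ) + 1)⁻¹) / 2 := by
    rw [Finset.sum_div, Finset.sum_filter, Finset.sum_filter, ← Fin.sum_univ_eq_sum_range
      (fun i : ℕ => if L ≤ (i : ℝ) + 1 then ((i : ℝ) + 1)⁻¹ / 2 else 0)]
    refine Finset.sum_congr rfl fun i _ => ?_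
    split_ifs
    · field_simp
    · rfl
  rw [h5]
  linarith

theorem mainTheorem12 (c : ℝ) (hc : 1 < c) (C : ℝ) (hC : 0 < C) :
    ∃ κ : ℝ, 0 < κ ∧ ∃ n₀ : ℕ, ∀ n : ℕ, n₀ ≤ n →
      ∀ (D : Type*) [LinearOrder D] [Infinite D] (M : Type*) [Countable M]
        (Ω : Type*) [MeasurableSpace Ω] (μ : Measure Ω) [IsProbabilityMeasure μ]
        (A : MonitoringAlgorithm n D M Ω),
        (∀ x : Fin n → D, Function.Injective x →
          1 - 1 / Real.log n ≤
            μ.real {ω | IsItemOfRankAtMost x (C * Real.log n ^ c) (A.result ω x)}) →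
        ∃ x : Fin n → D, Function.Injective x ∧
          ENNReal.ofReal (κ * Real.log n) ≤ ∫⁻ ω, (A.messages ω x : ENNReal) ∂μ := by
  have hlog : Filter.Tendsto (fun n : ℕ => Real.log n) Filter.atTop Filter.atTop :=
    Real.tendsto_log_atTop.comp tendsto_natCast_atTop_atTop
  -- Here `l` stands for `log n`: `4 ≤ l` gives success probability at least `3 / 4`, and the last
  -- condition says that dropping the ranks below `L` costs at most half of the harmonic sum's main
  -- term. Together with the factor `1 / 2` in each share, this gives `κ = 1 / 4`.
  have hlarge : ∀ᶠ l : ℝ in Filter.atTop, 4 ≤ l ∧ 1 ≤ C * l ^ c ∧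
      1 + Real.log (C * l ^ c) ≤ l / 2 := by
    have h1 := ((tendsto_rpow_atTop (by linarith : 0 < c)).const_mul_atTop hC).eventually_ge_atTop 1
    have h2 := (Real.isLittleO_log_id_atTop.const_mul_left c).bound (by norm_num : (0 : ℝ) < 1 / 4)
    filter_upwards [h1, h2, Filter.eventually_ge_atTop 4,
      Filter.eventually_ge_atTop (4 * (1 + Real.log C))] with l h1 h2 h3 h4
    refine ⟨h3, h1, ?_⟩
    rw [Real.log_mul hC.ne' (by positivity), Real.log_rpow (by linarith)]
    have h5 := (le_abs_self _).trans h2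
    rw [id, Real.norm_of_nonneg (by linarith : 0 ≤ l)] at h5
    linarith
  obtain ⟨n₀, hn₀⟩ := Filter.eventually_atTop.mp
    ((hlog.eventually hlarge).and (Filter.eventually_gt_atTop 0))
  refine ⟨1 / 4, by norm_num, n₀, fun n hn D _ _ M _ Ω _ μ _ A hA => ?_⟩
  obtain ⟨⟨hl4, hL, hlogL⟩, hn⟩ := hn₀ n hn
  have hl : 1 / Real.log n ≤ 1 / 4 := one_div_le_one_div_of_le (by norm_num) hl4
  obtain ⟨x, hx, hle⟩ := A.exists_le_lintegral_messages μ (L := C * Real.log n ^ c)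
    fun x hx => le_trans (by linarith) (hA x hx)
  refine ⟨x, hx, le_trans (ENNReal.ofReal_le_ofReal ?_) hle⟩
  have := log_sub_le_sum_inv n hL hn
  linarith
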